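/- **Theorem.** Let $\mathsf T$ be an essentially small triangulated category, and write $\mathsf{Ab}$ for the category of abelian groups. The following conditions are equivalent. 1. Every cohomological functor $\mathsf T^{\mathrm{op}}\to\mathsf{Ab}$ is isomorphic to a direct sum $\bigoplus_{i\in I}\operatorname{Hom}_{\mathsf T}(-,X_i)$ of representable functors, for some set $I$ and some family $(X_i)_{i\in I}$ of objects of $\mathsf T$. 2. Every object of $\mathsf T$ is a finite coproduct of indecomposable objects with local endomorphism rings, and for every sequence $X_1\xrightarrow{\phi_1}X_2\xrightarrow{\phi_2}X_3\xrightarrow{\phi_3}\cdots$ of non-isomorphisms between indecomposable objects of $\mathsf T$ there exists $n\ge 1$ such that $\phi_n\cdots\phi_2\phi_1=0$. 3. Idempotents in $\mathsf T$ split, and every object of the abelianisation $\mathbf A(\mathsf T)$ is noetherian, that is, every ascending chain of its subobjects in $\mathbf A(\mathsf T)$ eventually stabilises. Here $\mathbf A(\mathsf T)$ is the full subcategory of the category of functors $\mathsf T^{\mathrm{op}}\to\mathsf{Ab}$ consisting of all additive functors $F$ that fit into an exact sequence $\operatorname{Hom}_{\mathsf T}(-,X)\to\operatorname{Hom}_{\mathsf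 T}(-,Y)\to F\to 0$ with $X,Y\in\mathsf T$. A cohomological functor is an additive functor $F\colon\mathsf T^{\mathrm{op}}\to\mathsf{Ab}$ that sends each exact triangle $X\to Y\to Z\to \Sigma X$ to an exact sequence $F(Z)\to F(Y)\to F(X)$. -/

import Mathlib

open CategoryTheory CategoryTheory.Limits CategoryTheory.Pretriangulated Opposite
open scoped CategoryTheory.Pretriangulated.Opposite

universe v u

noncomputable section

namespace TriangulatedNoetherian

/-- A functor `Tᵒᵖ ⥤ Ab` is a direct sum of representable functors if it is isomorphic to
the coproduct, in the category of functors `Tᵒᵖ ⥤ Ab` (where coproducts are computed pointwise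
as direct sums of abelian groups), of a family of functors `Hom(-, X i)`. -/
def IsDirectSumOfRepresentables {T : Type u} [Category.{v} T] [Preadditive T]
    (F : Tᵒᵖ ⥤ AddCommGrpCat.{v}) : Prop :=
  ∃ (I : Type v) (X : I → T),
    Nonempty (F ≅ ∐ fun i : I => (preadditiveYoneda.obj (X i) : Tᵒᵖ ⥤ AddCommGrpCat.{v}))

/-- The property of functors `F : Tᵒᵖ ⥤ Ab` of being additive and of fitting into an exact
sequence `Hom(-, X) ⟶ Hom(-, Y) ⟶ F ⟶ 0` of functors. -/
def isFinitelyPresented (T : Type u) [Category.{v} T] [Preadditive T] :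
    ObjectProperty (Tᵒᵖ ⥤ AddCommGrpCat.{v}) := fun F =>
  F.Additive ∧
    ∃ (X Y : T) (φ : preadditiveYoneda.obj X ⟶ preadditiveYoneda.obj Y)
      (π : preadditiveYoneda.obj Y ⟶ F) (w : φ ≫ π = 0),
      (ShortComplex.mk φ π w).Exact ∧ Epi π

/-- The abelianisation `A(T)`: the full subcategory of the category of functors `Tᵒᵖ ⥤ Ab`
consisting of the additive functors with a presentation by representable functors. -/
abbrev Abelianisation (T : Type u) [Category.{v} T] [Preadditive T] : Type _ :=
  (isFinitelyPresented T).FullSubcategory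

/-- Every object is a finite coproduct of indecomposable objects with local endomorphism rings
(the empty coproduct is the zero object). -/
def IsKrullRemakSchmidt (T : Type u) [Category.{v} T] [Preadditive T]
    [HasFiniteBiproducts T] [HasBinaryBiproducts T] : Prop :=
  ∀ X : T, ∃ (n : ℕ) (Y : Fin n → T),
    (∀ i, Indecomposable (Y i) ∧ IsLocalRing (End (Y i))) ∧ Nonempty (X ≅ ⨁ Y)

/-- For a sequence `X 0 ⟶ X 1 ⟶ X 2 ⟶ ⋯` of morphisms `φ i : X i ⟶ X (i + 1)`, the composite
`X 0 ⟶ X (n + 1)` of the first `n + 1` morphisms `φ 0, …, φ n`. -/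
def chainComp {T : Type u} [Category.{v} T] {X : ℕ → T} (φ : ∀ i, X i ⟶ X (i + 1)) :
    ∀ n : ℕ, X 0 ⟶ X (n + 1)
  | 0 => φ 0
  | n + 1 => chainComp φ n ≫ φ (n + 1)

/-- Every infinite chain of non-isomorphisms between indecomposable objects eventually has
zero composite. -/
def ChainsEventuallyZero (T : Type u) [Category.{v} T] [Preadditive T]
    [HasBinaryBiproducts T] : Prop :=
  ∀ (X : ℕ → T) (φ : ∀ i, X i ⟶ X (i + 1)),
    (∀ i, Indecomposable (X i)) → (∀ i, ¬ IsIso (φ i)) → ∃ n : ℕ, chainComp φ n = 0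

end TriangulatedNoetherian

end

/-! The pivot is `SequencesStabilize`: along any sequence X₀ ⟶ X₁ ⟶ ⋯, for some n, the composite X₀
⟶ X_{n+1} is recovered from X₀ ⟶ X_{n+2} by postcomposition.

From (1): the colimit of the functors Hom(-, X_n) is cohomological, hence a direct sum of
representables. The element given by the identity of X₀ lies in a representable summand, and lifting
this summand to a finite stage (`exists_sequence_factor`) gives stabilisation; for a constant
sequence on an idempotent it gives a splitting.

Stabilisation matches noetherianity of the abelianisation. The kernels of the composites form an
ascending chain in Hom(-, X₀); conversely, an ascending chain of subobjects of a quotient of Hom(-,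
Y) is encoded by a sequence of weak cokernels starting at Y.

From stabilisation and split idempotents to (2): splitting off summands must stop, endomorphism
rings of indecomposables satisfy a chain condition that makes them local, and in a stationary
composite c = c f either f or 1 - f is invertible.

From (2) to (1): choose a family in F that is a basis modulo the radical
(`exists_basis_mod_radical`). Vanishing of chains replaces nilpotency in Nakayama's lemma, so the
family generates F (`spanOn_eq_top`). It also excludes nontrivial relations
(`eq_zero_of_sum_eq_zero`), because for cohomological F every nonzero relation can be prolonged by
another one (`exists_relation`). -/

namespace TriangulatedNoetherian

/-! ### Weak kernels and weak cokernels from exact triangles. -/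

section WeakKernels

variable {T : Type u} [Category.{v} T] [Preadditive T] [HasZeroObject T]
  [HasShift T ℤ] [∀ n : ℤ, (shiftFunctor T n).Additive] [Pretriangulated T]

/-- A morphism in a pretriangulated category has a weak kernel of which it is a weak cokernel. -/
lemma exists_weakKernel {X Y : T} (f : X ⟶ Y) :
    ∃ (K : T) (k : K ⟶ X), k ≫ f = 0 ∧
      (∀ {C : T} (c : C ⟶ X), c ≫ f = 0 → ∃ c', c' ≫ k = c) ∧
      ∀ {W : T} (h : X ⟶ W), k ≫ h = 0 → ∃ t, f ≫ t = h := by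
  obtain ⟨K, k, w, hT⟩ := distinguished_cocone_triangle₁ f
  refine ⟨K, k, comp_distTriang_mor_zero₁₂ _ hT, fun c hc ↦ ?_, fun h hh ↦ ?_⟩
  · obtain ⟨c', hc'⟩ := Triangle.coyoneda_exact₂ _ hT c hc
    exact ⟨c', hc'.symm⟩
  · obtain ⟨t, ht⟩ := Triangle.yoneda_exact₂ _ hT h hh
    exact ⟨t, ht.symm⟩

/-- A morphism in a pretriangulated category has a weak cokernel of which it is a weak kernel,
and homological functors are exact at its target. -/
lemma exists_weakCokernel {X Y : T} (f : X ⟶ Y) :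
    ∃ (Z : T) (g : Y ⟶ Z), f ≫ g = 0 ∧
      (∀ {C : T} (c : C ⟶ Y), c ≫ g = 0 → ∃ c', c' ≫ f = c) ∧
      (∀ {W : T} (h : Y ⟶ W), f ≫ h = 0 → ∃ t, g ≫ t = h) ∧
      ∀ (F : Tᵒᵖ ⥤ AddCommGrpCat.{v}) [F.IsHomological] (y : F.obj (op Y)),
        F.map f.op y = 0 → ∃ z : F.obj (op Z), F.map g.op z = y := by
  obtain ⟨Z, g, w, hT⟩ := distinguished_cocone_triangle f
  refine ⟨Z, g, comp_distTriang_mor_zero₁₂ _ hT, fun c hc ↦ ?_, fun h hh ↦ ?_, fun F _ y hy ↦ ?_⟩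
  · obtain ⟨c', hc'⟩ := Triangle.coyoneda_exact₂ _ hT c hc
    exact ⟨c', hc'.symm⟩
  · obtain ⟨t, ht⟩ := Triangle.yoneda_exact₂ _ hT h hh
    exact ⟨t, ht.symm⟩
  · have := F.map_distinguished_op_exact _ hT
    rw [ShortComplex.ab_exact_iff] at this
    exact this y hy

end WeakKernels

/-! ### Elements of additive functors and of coproducts of functors. -/

section Sums

lemma map_op_comp_apply {T : Type u} [Category.{v} T] (F : Tᵒᵖ ⥤ AddCommGrpCat.{v}) {X Y Z : T}
    (f : X ⟶ Y) (g : Y ⟶ Z) (z : F.obj (op Z)) :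
    F.map (f ≫ g).op z = F.map f.op (F.map g.op z) := by
  simp

lemma map_op_id_apply {T : Type u} [Category.{v} T] (F : Tᵒᵖ ⥤ AddCommGrpCat.{v}) {X : T}
    (x : F.obj (op X)) : F.map (𝟙 X).op x = x := by
  simp

variable {T : Type u} [Category.{v} T] [Preadditive T]

lemma map_op_sub_apply (F : Tᵒᵖ ⥤ AddCommGrpCat.{v}) [F.Additive] {X Y : T}
    (f g : X ⟶ Y) (y : F.obj (op Y)) :
    F.map (f - g).op y = F.map f.op y - F.map g.op y := by
  rw [op_sub, F.map_sub]
  rfl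

lemma map_op_add_apply (F : Tᵒᵖ ⥤ AddCommGrpCat.{v}) [F.Additive] {X Y : T}
    (f g : X ⟶ Y) (y : F.obj (op Y)) :
    F.map (f + g).op y = F.map f.op y + F.map g.op y := by
  rw [op_add, F.map_add]
  rfl

lemma map_op_zero_apply (F : Tᵒᵖ ⥤ AddCommGrpCat.{v}) [F.Additive] {X Y : T}
    (y : F.obj (op Y)) : F.map (0 : X ⟶ Y).op y = 0 := by
  rw [op_zero, F.map_zero]
  rfl

lemma map_op_sum_apply (F : Tᵒᵖ ⥤ AddCommGrpCat.{v}) [F.Additive] {X Y : T} {ι : Type*}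
    (s : Finset ι) (f : ι → (X ⟶ Y)) (y : F.obj (op Y)) :
    F.map (∑ i ∈ s, f i).op y = ∑ i ∈ s, F.map (f i).op y := by
  classical
  induction s using Finset.induction_on with
  | empty => simp
  | insert i s hi ih => rw [Finset.sum_insert hi, Finset.sum_insert hi, map_op_add_apply, ih]

end Sums

section Coproducts

variable {C : Type u} [Category.{v} C]

/-- An additive subgroup containing the images of all coprojections is everything. -/
lemma addSubgroup_eq_top_of_ι_mem {I : Type v} (G : I → Cᵒᵖ ⥤ AddCommGrpCat.{v}) (X : Cᵒᵖ)
    (S : AddSubgroup ((∐ G).obj X)) (hS : ∀ i (x : (G i).obj X), (Sigma.ι G i).app X x ∈ S) :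
    S = ⊤ := by
  let q : (∐ G).obj X ⟶ AddCommGrpCat.of ((∐ G).obj X ⧸ S) :=
    AddCommGrpCat.ofHom (QuotientAddGroup.mk' S)
  have hq : q = 0 := by
    have hc := isColimitOfPreserves ((evaluation _ _).obj X) (coproductIsCoproduct G)
    refine hc.hom_ext fun ⟨i⟩ ↦ ?_
    ext x
    exact (QuotientAddGroup.eq_zero_iff _).2 (hS i x)
  rw [eq_top_iff]
  intro x _
  rw [← QuotientAddGroup.eq_zero_iff]
  exact ConcreteCategory.congr_hom hq x

end Coproducts

/-- For every sequence of morphisms, the left ideals generated by the composites of the first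
morphisms become stationary. -/
def SequencesStabilize (T : Type u) [Category.{v} T] : Prop :=
  ∀ (X : ℕ → T) (φ : ∀ i, X i ⟶ X (i + 1)), ∃ (n : ℕ) (r : X (n + 2) ⟶ X (n + 1)),
    chainComp φ n ≫ φ (n + 1) ≫ r = chainComp φ n

/-! ### Infinite chains and their composites. -/

section Chains

variable {T : Type u} [Category.{v} T] [Preadditive T] [HasBinaryBiproducts T]

/-- Dependent choice: if every morphism satisfying P can be prolonged by a non-isomorphism within P,
iteration yields a chain whose composites all satisfy P and so never vanish. Generation and
independence of the basis both rest on this. -/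
lemma false_of_chainsEventuallyZero (hT : ChainsEventuallyZero T) {C : T}
    (P : ∀ D : T, (C ⟶ D) → Prop) (hP : ∀ D ψ, P D ψ → Indecomposable D ∧ ψ ≠ 0)
    (h₀ : P C (𝟙 C))
    (hs : ∀ D ψ, P D ψ → ∃ (D' : T) (φ : D ⟶ D'), ¬ IsIso φ ∧ P D' (ψ ≫ φ)) : False := by
  choose D' φ hφ hP' using hs
  let s : ℕ → Σ' (D : T) (ψ : C ⟶ D), P D ψ := fun n ↦ Nat.rec ⟨C, 𝟙 C, h₀⟩
    (fun _ a ↦ ⟨D' a.1 a.2.1 a.2.2, _, hP' a.1 a.2.1 a.2.2⟩) n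
  obtain ⟨n, hn⟩ := hT (fun n ↦ (s n).1) (fun n ↦ φ _ _ (s n).2.2)
    (fun n ↦ (hP _ _ (s n).2.2).1) (fun n ↦ hφ _ _ _)
  refine (hP _ _ (s (n + 1)).2.2).2 (Eq.trans ?_ hn)
  clear hn
  induction n with
  | zero => exact Category.id_comp _
  | succ n ih => exact congrArg (· ≫ φ _ _ (s (n + 1)).2.2) ih

omit [Preadditive T] [HasBinaryBiproducts T] in
lemma chainComp_eq_map {X : ℕ → T} (φ : ∀ i, X i ⟶ X (i + 1)) (n : ℕ) :
    chainComp φ n = (Functor.ofSequence φ).map (homOfLE (Nat.zero_le (n + 1))) := by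
  induction n with
  | zero => exact (Functor.ofSequence_map_homOfLE_succ φ 0).symm
  | succ n ih =>
    exact (congrArg₂ (· ≫ ·) ih (Functor.ofSequence_map_homOfLE_succ φ (n + 1)).symm).trans
      ((Functor.ofSequence φ).map_comp _ _).symm

end Chains

/-! ### Local rings from a chain condition. -/

section Rings

/-- A nontrivial ring with trivial idempotents and the descending chain condition on principal
left ideals is local. -/
lemma isLocalRing_of_chainCondition {R : Type*} [Ring R] [Nontrivial R]
    (hidem : ∀ e : R, e * e = e → e = 0 ∨ e = 1)
    (hchain : ∀ c : ℕ → R, (∀ n, c (n + 1) ∈ Submodule.span R {c n}) →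
      ∃ n, c n ∈ Submodule.span R {c (n + 1)}) : IsLocalRing R := by
  simp only [Submodule.mem_span_singleton, smul_eq_mul] at hchain
  have hwf : WellFounded fun x y : R ↦ (∃ r, r * y = x) ∧ ¬ ∃ r, r * x = y := by
    rw [wellFounded_iff_isEmpty_descending_chain]
    refine ⟨fun ⟨c, hc⟩ ↦ ?_⟩
    obtain ⟨n, hn⟩ := hchain c fun n ↦ (hc n).1
    exact (hc n).2 hn
  have left_inv (a : R) (ha : ¬ IsNilpotent a) : ∃ b, b * a = 1 := by
    -- Among the non-nilpotent left multiples of a, m generates a minimal left ideal. As m² is not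
    -- nilpotent, m = b m², and c = b m satisfies c m = m.
    obtain ⟨m, ⟨hm, r, rfl⟩, hmin⟩ := hwf.has_min {x | ¬ IsNilpotent x ∧ ∃ r, r * a = x}
      ⟨a, ha, 1, one_mul a⟩
    set m := r * a with hm'
    have key (x : R) (hx : ∃ t, t * m = x) (hx' : ¬ IsNilpotent x) : ∃ t, t * x = m := by
      by_contra h
      refine hmin x ⟨hx', ?_⟩ ⟨hx, h⟩
      obtain ⟨t, rfl⟩ := hx
      exact ⟨t * r, by rw [hm', mul_assoc]⟩
    obtain ⟨b, hb⟩ := key (m * m) ⟨m, rfl⟩ fun h ↦ hm (by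
      rw [← pow_two] at h; exact (IsNilpotent.pow_iff_pos two_ne_zero).1 h)
    set c := b * m with hc
    have hcm : c * m = m := by rw [hc, mul_assoc, hb]
    have hcpow (n : ℕ) : c ^ n * m = m := by
      induction n with
      | zero => simp
      | succ n ih => rw [pow_succ, mul_assoc, hcm, ih]
    have hm0 : m ≠ 0 := fun h ↦ hm (h ▸ IsNilpotent.zero)
    have hcn : ∀ n, c ^ n ≠ 0 := fun n h ↦ hm0 (by rw [← hcpow n, h, zero_mul])
    -- Otherwise minimality gives m = t (1 - c) c, whence m² = t (1 - c) m = 0.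
    have hnil : IsNilpotent ((1 - c) * c) := by
      by_contra h
      obtain ⟨t, ht⟩ := key _ ⟨(1 - c) * b, by rw [mul_assoc]⟩ h
      refine hm ⟨2, ?_⟩
      rw [pow_two]
      nth_rw 1 [← ht]
      rw [mul_assoc, mul_assoc, hcm, sub_mul, one_mul, hcm, sub_self, mul_zero]
    obtain ⟨n, hn⟩ := hnil
    have hn0 : n ≠ 0 := fun h ↦ one_ne_zero (α := R) (by rw [← hn, h, pow_zero])
    -- X^n divides E and (1 - X)^n divides 1 - E, so E(c) is idempotent. E(c) = 0 would force c^n =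
    -- 0; E(c) = 1 makes c = b r a left invertible, and with it a.
    let E : Polynomial ℤ := 1 - (1 - Polynomial.X ^ n) ^ n
    obtain ⟨H, hH⟩ : Polynomial.X ^ n ∣ E := by
      have := sub_dvd_pow_sub_pow (1 : Polynomial ℤ) (1 - Polynomial.X ^ n) n
      rwa [sub_sub_cancel, one_pow] at this
    obtain ⟨Q, hQ⟩ : (1 - Polynomial.X) ^ n ∣ 1 - E := by
      simp only [E, sub_sub_cancel]
      refine pow_dvd_pow_of_dvd ?_ n
      simpa using sub_dvd_pow_sub_pow (1 : Polynomial ℤ) Polynomial.X n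
    have hzero : Polynomial.aeval c (Polynomial.X ^ n * (1 - E)) = 0 := by
      rw [hQ, ← mul_assoc, mul_comm (Polynomial.X ^ n), ← mul_pow]
      simp [hn]
    have hE : Polynomial.aeval c E = Polynomial.aeval c H * c ^ n := by
      rw [hH, mul_comm]
      simp
    have hidemE : Polynomial.aeval c E * Polynomial.aeval c E = Polynomial.aeval c E := by
      have h : Polynomial.aeval c (E * (1 - E)) = 0 := by
        have h' : E * (1 - E) = H * (Polynomial.X ^ n * (1 - E)) := by
          rw [← mul_assoc, mul_comm H, ← hH]
        rw [h', map_mul, hzero, mul_zero]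
      rw [mul_sub, mul_one, map_sub, map_mul, sub_eq_zero] at h
      exact h.symm
    rcases hidem _ hidemE with h | h
    · rw [map_mul, map_sub, h] at hzero
      simp only [map_pow, Polynomial.aeval_X, map_one, sub_zero, mul_one] at hzero
      exact (hcn n hzero).elim
    · obtain ⟨k, rfl⟩ := Nat.exists_eq_succ_of_ne_zero hn0
      refine ⟨Polynomial.aeval c H * c ^ k * b * r, ?_⟩
      rw [mul_assoc, ← hm', mul_assoc, ← hc, mul_assoc, ← pow_succ, ← hE, h]
  refine IsLocalRing.of_isUnit_or_isUnit_one_sub_self fun a ↦ ?_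
  by_cases ha : IsNilpotent a
  · exact Or.inr ha.isUnit_one_sub
  · obtain ⟨b, hb⟩ := left_inv a ha
    refine Or.inl (isUnit_iff_exists.2 ⟨b, ?_, hb⟩)
    rcases hidem (a * b) (by rw [mul_assoc, ← mul_assoc b, hb, one_mul]) with h | h
    · refine (ha ⟨1, ?_⟩).elim
      rw [pow_one, ← mul_one a, ← hb, ← mul_assoc, h, zero_mul]
    · exact h

end Rings

/-! ### Direct sums of representable functors, handled through elements. -/

section YonedaElements

variable {T : Type u} [Category.{v} T] [Preadditive T] {F : Tᵒᵖ ⥤ AddCommGrpCat.{v}} {Y : T}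

/-- The action on elements of a natural transformation from a representable functor. -/
def ofHom (σ : preadditiveYoneda.obj Y ⟶ F) {C : T} : (C ⟶ Y) →+ F.obj (op C) :=
  (σ.app (op C)).hom

/-- The action on elements of a natural transformation to a representable functor. -/
def toHom (ρ : F ⟶ preadditiveYoneda.obj Y) {C : T} : F.obj (op C) →+ (C ⟶ Y) :=
  (ρ.app (op C)).hom

lemma map_ofHom (σ : preadditiveYoneda.obj Y ⟶ F) {C D : T} (f : C ⟶ D) (c : D ⟶ Y) :
    F.map f.op (ofHom σ c) = ofHom σ (f ≫ c) :=
  (NatTrans.naturality_apply σ f.op c).symm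

lemma toHom_map (ρ : F ⟶ preadditiveYoneda.obj Y) {C D : T} (f : C ⟶ D) (x : F.obj (op D)) :
    toHom ρ (F.map f.op x) = f ≫ toHom ρ x :=
  NatTrans.naturality_apply ρ f.op x

lemma toHom_ofHom {Z : T} (σ : preadditiveYoneda.obj Y ⟶ F) (ρ : F ⟶ preadditiveYoneda.obj Z)
    (g : Y ⟶ Z) (h : σ ≫ ρ = preadditiveYoneda.map g) {C : T} (c : C ⟶ Y) :
    toHom ρ (ofHom σ c) = c ≫ g :=
  ConcreteCategory.congr_hom (congrArg (fun t : preadditiveYoneda.obj Y ⟶ preadditiveYoneda.obj Z ↦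
    t.app (op C)) h) c

end YonedaElements

section DirectSums

variable {T : Type u} [Category.{v} T] [Preadditive T]

/-- The direct sum of a family of representable functors. -/
noncomputable abbrev sumYoneda {I : Type v} (X : I → T) : Tᵒᵖ ⥤ AddCommGrpCat.{v} :=
  ∐ fun i ↦ preadditiveYoneda.obj (X i)

/-- The coprojections of a direct sum of representable functors. -/
noncomputable abbrev sumι {I : Type v} (X : I → T) (i : I) : preadditiveYoneda.obj (X i) ⟶ sumYoneda X :=
  Sigma.ι (fun i ↦ (preadditiveYoneda.obj (X i) : Tᵒᵖ ⥤ AddCommGrpCat.{v})) i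

/-- Every element of a direct sum of representables is a finite sum of elements of the summands. -/
lemma exists_eq_sum_ι {I : Type v} (X : I → T) {C : T} (x : (sumYoneda X).obj (op C)) :
    ∃ (s : Finset I) (a : ∀ i, C ⟶ X i), x = ∑ i ∈ s, ofHom (sumι X i) (a i) := by
  classical
  let f : DirectSum I (fun i ↦ C ⟶ X i) →+ (sumYoneda X).obj (op C) :=
    DirectSum.toAddMonoid fun i ↦ ofHom (sumι X i)
  have hf : f.range = ⊤ := addSubgroup_eq_top_of_ι_mem _ _ _ fun i a ↦
    ⟨DirectSum.of (fun i ↦ C ⟶ X i) i a, DirectSum.toAddMonoid_of _ _ _⟩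
  obtain ⟨a, rfl⟩ : x ∈ f.range := hf ▸ AddSubgroup.mem_top x
  exact ⟨a.support, a, DFinsupp.sumAddHom_apply _ _⟩

lemma sum_π_comp_ι [HasFiniteBiproducts T] {J : Type*} [Fintype J] (f : J → T) :
    ∑ j, biproduct.π f j ≫ biproduct.ι f j = 𝟙 (⨁ f) :=
  IsBilimit.total (biproduct.isBilimit f)

/-- An element involves finitely many summands. Y is their biproduct, y its universal element and ρ
the projection that kills all other summands; thus y embeds Hom(-, Y) as a direct summand containing
x. -/
lemma sumYoneda_exists_factor [HasFiniteBiproducts T] {I : Type v} (X : I → T) {C : T}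
    (x : (sumYoneda X).obj (op C)) :
    ∃ (Y : T) (y : (sumYoneda X).obj (op Y)) (p : C ⟶ Y)
      (ρ : sumYoneda X ⟶ preadditiveYoneda.obj Y),
      (sumYoneda X).map p.op y = x ∧ toHom ρ y = 𝟙 Y := by
  classical
  obtain ⟨s, a, rfl⟩ := exists_eq_sum_ι X x
  let Z : s → T := fun i ↦ X i
  refine ⟨⨁ Z, ∑ i : s, ofHom (sumι X i) (biproduct.π Z i), biproduct.lift fun i ↦ a i,
    Sigma.desc fun i ↦ if h : i ∈ s then preadditiveYoneda.map (biproduct.ι Z ⟨i, h⟩) else 0, ?_, ?_⟩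
  · rw [map_sum, ← Finset.sum_coe_sort s]
    refine Finset.sum_congr rfl fun i _ ↦ ?_
    rw [map_ofHom, biproduct.lift_π]
  · rw [map_sum]
    refine Eq.trans ?_ (sum_π_comp_ι Z)
    refine Finset.sum_congr rfl fun i _ ↦ toHom_ofHom _ _ _ ?_ _
    simp [sumι]

lemma IsDirectSumOfRepresentables.exists_factor [HasFiniteBiproducts T]
    {F : Tᵒᵖ ⥤ AddCommGrpCat.{v}} (hF : IsDirectSumOfRepresentables F) {C : T} (x : F.obj (op C)) :
    ∃ (Y : T) (y : F.obj (op Y)) (p : C ⟶ Y) (ρ : F ⟶ preadditiveYoneda.obj Y),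
      F.map p.op y = x ∧ toHom ρ y = 𝟙 Y := by
  obtain ⟨I, X, ⟨e⟩⟩ := hF
  obtain ⟨Y, y, p, ρ, h₁, h₂⟩ := sumYoneda_exists_factor X (e.hom.app (op C) x)
  refine ⟨Y, e.inv.app (op Y) y, p, e.hom ≫ ρ, ?_, ?_⟩
  · rw [← NatTrans.naturality_apply, h₁]
    simp
  · refine Eq.trans ?_ h₂
    exact congrArg (toHom ρ) (e.inv_hom_id_app_apply _ y)

end DirectSums

/-! ### Sequential colimits of representables, and the consequences of condition (1). -/

section SequentialColimits

variable {T : Type u} [Category.{v} T] [Preadditive T]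

/-- The colimit of the functors represented by the objects of a sequence. -/
noncomputable abbrev indFunctor (G : ℕ ⥤ T) : Tᵒᵖ ⥤ AddCommGrpCat.{v} :=
  colimit (G ⋙ preadditiveYoneda)

/-- The natural map from `Hom(-, G n)` to the colimit. -/
noncomputable abbrev indι (G : ℕ ⥤ T) (n : ℕ) : preadditiveYoneda.obj (G.obj n) ⟶ indFunctor G :=
  colimit.ι (G ⋙ preadditiveYoneda) n

lemma ofHom_indι_comp_map (G : ℕ ⥤ T) {n m : ℕ} (h : n ⟶ m) {C : T} (c : C ⟶ G.obj n) :
    ofHom (indι G m) (c ≫ G.map h) = ofHom (indι G n) c :=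
  ConcreteCategory.congr_hom (congrArg (fun t : preadditiveYoneda.obj (G.obj n) ⟶ indFunctor G ↦
    t.app (op C)) (colimit.w (G ⋙ preadditiveYoneda) h)) c

instance : PreservesFilteredColimitsOfSize.{0, 0} (forget AddCommGrpCat.{v}) :=
  preservesFilteredColimitsOfSize_shrink _

lemma exists_ofHom_indι (G : ℕ ⥤ T) {C : T} (x : (indFunctor G).obj (op C)) :
    ∃ (n : ℕ) (c : C ⟶ G.obj n), ofHom (indι G n) c = x :=
  Concrete.isColimit_exists_rep _ (isColimitOfPreserves ((evaluation _ _).obj (op C))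
    (colimit.isColimit (G ⋙ preadditiveYoneda))) x

lemma exists_comp_map_eq_zero (G : ℕ ⥤ T) {C : T} {n : ℕ} (c : C ⟶ G.obj n)
    (hc : ofHom (indι G n) c = 0) : ∃ (m : ℕ) (h : n ⟶ m), c ≫ G.map h = 0 := by
  obtain ⟨m, f, g, h⟩ := (Concrete.isColimit_rep_eq_iff_exists _
    (isColimitOfPreserves ((evaluation _ _).obj (op C))
      (colimit.isColimit (G ⋙ preadditiveYoneda))) (i := n) (j := n) c (0 : C ⟶ G.obj n)).1
    (hc.trans (map_zero (ofHom (indι G n))).symm)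
  exact ⟨m, f, h.trans (map_zero (((G ⋙ preadditiveYoneda).map g).app (op C)).hom)⟩

variable [HasZeroObject T]
  [HasShift T ℤ] [∀ n : ℤ, (shiftFunctor T n).Additive] [Pretriangulated T]

/-- Elements of the colimit, and their vanishing, are witnessed at finite stages, so exactness is
inherited from the functors Hom(-, G m). -/
instance (G : ℕ ⥤ T) : (indFunctor G).IsHomological where
  map_zero X Y := by
    ext x
    obtain ⟨n, c, rfl⟩ := exists_ofHom_indι G x
    exact (map_ofHom (indι G n) 0 c).trans (by simp)
  exact S hS := by
    rw [ShortComplex.ab_exact_iff]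
    intro x hx
    obtain ⟨n, c, rfl⟩ := exists_ofHom_indι G x
    obtain ⟨m, h, hm⟩ := exists_comp_map_eq_zero G (S.mor₂.unop ≫ c)
      ((map_ofHom (indι G n) _ c).symm.trans hx)
    obtain ⟨d, hd⟩ := Triangle.yoneda_exact₂ _ (unop_distinguished S hS) (c ≫ G.map h)
      ((Category.assoc _ _ _).symm.trans hm)
    refine ⟨ofHom (indι G m) d, (map_ofHom (indι G m) _ d).trans ?_⟩
    exact (congrArg _ hd.symm).trans (ofHom_indι_comp_map G h c)

variable (hT : ∀ F : Tᵒᵖ ⥤ AddCommGrpCat.{v}, F.IsHomological → IsDirectSumOfRepresentables F)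

include hT

/-- Apply the factorisation to the class of the identity of G 0. The embedding of Hom(-, Y) is
represented at a stage m by q, and its retraction gives the compatible maps p n. The last equation
holds in the colimit for N = m, hence holds in T at some later stage N. -/
lemma exists_sequence_factor (G : ℕ ⥤ T) :
    ∃ (Y : T) (m : ℕ) (q : Y ⟶ G.obj m) (p : ∀ n, G.obj n ⟶ Y),
      (∀ {i j : ℕ} (h : i ⟶ j), G.map h ≫ p j = p i) ∧ q ≫ p m = 𝟙 Y ∧
      ∃ (N : ℕ) (h : m ⟶ N), p 0 ≫ q ≫ G.map h = G.map (homOfLE (Nat.zero_le N)) := by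
  obtain ⟨Y, y, p, ρ, h₁, h₂⟩ := (hT (indFunctor G) inferInstance).exists_factor
    (ofHom (indι G 0) (𝟙 (G.obj 0)))
  obtain ⟨m, q, rfl⟩ := exists_ofHom_indι G y
  have hρ {n : ℕ} {C : T} (c : C ⟶ G.obj n) :
      toHom ρ (ofHom (indι G n) c) = c ≫ toHom ρ (ofHom (indι G n) (𝟙 _)) := by
    rw [← toHom_map, map_ofHom, Category.comp_id]
  have hp : p = toHom ρ (ofHom (indι G 0) (𝟙 _)) := by
    rw [← h₁, toHom_map, h₂, Category.comp_id]
  refine ⟨Y, m, q, fun n ↦ toHom ρ (ofHom (indι G n) (𝟙 _)), fun {i j} h ↦ ?_, ?_, ?_⟩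
  · rw [← hρ, ← Category.id_comp (G.map h), ofHom_indι_comp_map]
  · rw [← hρ, h₂]
  · rw [map_ofHom] at h₁
    beta_reduce
    rw [← hp]
    have : ofHom (indι G m) (p ≫ q - G.map (homOfLE (Nat.zero_le m))) = 0 := by
      rw [map_sub, h₁, ← Category.id_comp (G.map _), ofHom_indι_comp_map, sub_self]
    obtain ⟨N, h, hN⟩ := exists_comp_map_eq_zero G _ this
    refine ⟨N, h, ?_⟩
    rw [Preadditive.sub_comp, sub_eq_zero, Category.assoc, ← G.map_comp] at hN
    exact hN

/-- The composite into X (N + 1) factors through p 0, and p 0 factors through the composite into X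
(N + 2) because the maps p are compatible. -/
lemma sequencesStabilize_of_isDirectSumOfRepresentables : SequencesStabilize T := by
  intro X φ
  obtain ⟨Y, m, q, p, hp, -, N, h, hN⟩ := exists_sequence_factor hT (Functor.ofSequence φ)
  have h₁ : chainComp φ (N + 1) ≫ p (N + 2) = p 0 := by
    rw [chainComp_eq_map]
    exact hp (homOfLE (Nat.zero_le (N + 2)))
  have h₂ : chainComp φ N =
      p 0 ≫ q ≫ (Functor.ofSequence φ).map (h ≫ homOfLE (Nat.le_succ N)) := by
    rw [chainComp_eq_map, Functor.map_comp]
    refine ((Functor.ofSequence φ).map_comp (homOfLE (Nat.zero_le N))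
      (homOfLE (Nat.le_succ N))).trans ?_
    rw [← hN]
    simp only [Category.assoc]
  have key (p' : X (N + 2) ⟶ Y) (s : Y ⟶ X (N + 1)) (p₀ : X 0 ⟶ Y)
      (h₁ : chainComp φ (N + 1) ≫ p' = p₀) (h₂ : chainComp φ N = p₀ ≫ s) :
      chainComp φ N ≫ φ (N + 1) ≫ p' ≫ s = chainComp φ N := by
    refine Eq.trans ?_ h₂.symm
    rw [← h₁]
    simp only [chainComp, Category.assoc]
  exact ⟨N, _, key _ _ _ h₁ h₂⟩

lemma isIdempotentComplete_of_isDirectSumOfRepresentables : IsIdempotentComplete T where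
  idempotents_split X e he := by
    let G : ℕ ⥤ T := Functor.ofSequence (X := fun _ ↦ X) fun _ ↦ e
    have hG (n : ℕ) : G.map (homOfLE (Nat.le_succ n)) = e :=
      Functor.ofSequence_map_homOfLE_succ (X := fun _ ↦ X) (fun _ ↦ e) n
    have hG' {i j : ℕ} (h : i ≤ j) : (show X ⟶ X from G.map (homOfLE h)) ≫ e = e := by
      induction j, h using Nat.le_induction with
      | base => exact (congrArg (· ≫ e) (G.map_id i)).trans (Category.id_comp e)
      | succ j h ih =>
        exact (congrArg (· ≫ e) ((G.map_comp (homOfLE h) (homOfLE (Nat.le_succ j))).trans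
          ((congrArg (G.map (homOfLE h) ≫ ·) (hG j)).trans ih))).trans he
    -- The transition maps g and f are powers of e, possibly identities; postcomposing with e turns
    -- both into e.
    obtain ⟨Y, q, p, hp, ⟨m, hq⟩, g, hg, f, hf, hN⟩ : ∃ (Y : T) (q : Y ⟶ X) (p : ℕ → (X ⟶ Y)),
        (∀ n, e ≫ p (n + 1) = p n) ∧ (∃ m, q ≫ p m = 𝟙 Y) ∧
        ∃ g : X ⟶ X, g ≫ e = e ∧ ∃ f : X ⟶ X, f ≫ e = e ∧ p 0 ≫ q ≫ g = f := by
      obtain ⟨Y, m, q, p, hp, hq, N, h, hN⟩ := exists_sequence_factor hT G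
      exact ⟨Y, q, p, fun n ↦ (congrArg (· ≫ p (n + 1)) (hG n).symm).trans
        (hp (homOfLE (Nat.le_succ n))), ⟨m, hq⟩, G.map h, hG' (leOfHom h), _,
        hG' (Nat.zero_le N), hN⟩
    have hpe (n : ℕ) : e ≫ p n = p n := by
      rw [← hp n, reassoc_of% he]
    have hp0 (n : ℕ) : p n = p 0 := by
      induction n with
      | zero => rfl
      | succ n ih => rw [← ih, ← hpe, hp]
    refine ⟨Y, q ≫ e, p 0, ?_, ?_⟩
    · rw [Category.assoc, hpe, ← hp0 m, hq]
    · refine Eq.trans ?_ hf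
      rw [← hN]
      simp only [Category.assoc, hg]

end SequentialColimits

variable {T : Type u} [Category.{v} T]

/-! ### Decomposition into indecomposables and vanishing of chains, from stabilisation. -/

section Decomposition

variable [Preadditive T] [HasFiniteBiproducts T] [HasBinaryBiproducts T]

/-- An object is a finite coproduct of indecomposable objects. -/
def IsFiniteSumOfIndecomposables (X : T) : Prop :=
  ∃ (n : ℕ) (Y : Fin n → T), (∀ i, Indecomposable (Y i)) ∧ Nonempty (X ≅ ⨁ Y)

lemma isFiniteSumOfIndecomposables_of_fintype {J : Type} [Fintype J] {X : T} (Y : J → T)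
    (hY : ∀ j, Indecomposable (Y j)) (e : X ≅ ⨁ Y) : IsFiniteSumOfIndecomposables X :=
  ⟨Fintype.card J, fun i ↦ Y ((Fintype.equivFin J).symm i), fun _ ↦ hY _,
    ⟨e ≪≫ biproduct.whiskerEquiv (Fintype.equivFin J) fun j ↦ eqToIso (by simp)⟩⟩

/-- A biproduct over a disjoint union is a biproduct of two biproducts. -/
lemma nonempty_biprod_biproduct_iso {J K : Type} [Fintype J] [Fintype K] (W : J ⊕ K → T) :
    Nonempty ((⨁ fun j ↦ W (Sum.inl j)) ⊞ (⨁ fun k ↦ W (Sum.inr k)) ≅ ⨁ W) := by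
  refine ⟨⟨biprod.desc (biproduct.desc fun j ↦ biproduct.ι W (Sum.inl j))
    (biproduct.desc fun k ↦ biproduct.ι W (Sum.inr k)),
    biprod.lift (biproduct.lift fun j ↦ biproduct.π W (Sum.inl j))
    (biproduct.lift fun k ↦ biproduct.π W (Sum.inr k)), ?_, ?_⟩⟩
  · apply biprod.hom_ext'
    · refine biproduct.hom_ext' _ _ fun j ↦ biprod.hom_ext _ _ (biproduct.hom_ext _ _ fun j' ↦ ?_)
        (biproduct.hom_ext _ _ fun k' ↦ ?_)
      · by_cases h : j = j'
        · subst h; simp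
        · have h' : Sum.inl (β := K) j ≠ Sum.inl j' := by simpa using h
          simp [biproduct.ι_π_ne _ h, biproduct.ι_π_ne _ h']
      · have h' : Sum.inl j ≠ Sum.inr k' := by simp
        simp [biproduct.ι_π_ne _ h']
    · refine biproduct.hom_ext' _ _ fun k ↦ biprod.hom_ext _ _ (biproduct.hom_ext _ _ fun j' ↦ ?_)
        (biproduct.hom_ext _ _ fun k' ↦ ?_)
      · have h' : Sum.inr k ≠ Sum.inl j' := by simp
        simp [biproduct.ι_π_ne _ h']
      · by_cases h : k = k'
        · subst h; simp
        · have h' : Sum.inr (α := J) k ≠ Sum.inr k' := by simpa using h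
          simp [biproduct.ι_π_ne _ h, biproduct.ι_π_ne _ h']
  · rw [biprod.lift_desc, biproduct.lift_desc, biproduct.lift_desc, ← sum_π_comp_ι W,
      Fintype.sum_sum_type]

lemma IsFiniteSumOfIndecomposables.biprod {X Y Z : T} (e : X ≅ Y ⊞ Z)
    (hY : IsFiniteSumOfIndecomposables Y) (hZ : IsFiniteSumOfIndecomposables Z) :
    IsFiniteSumOfIndecomposables X := by
  obtain ⟨n, Y', hY', ⟨eY⟩⟩ := hY
  obtain ⟨m, Z', hZ', ⟨eZ⟩⟩ := hZ
  obtain ⟨f⟩ := nonempty_biprod_biproduct_iso (Sum.elim Y' Z')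
  exact isFiniteSumOfIndecomposables_of_fintype (Sum.elim Y' Z')
    (by rintro (i | i); exacts [hY' i, hZ' i]) (e ≪≫ biprod.mapIso eY eZ ≪≫ f)

/-- Such an X is a biproduct of two nonzero objects, one of which is again not a finite sum of
indecomposables; p is the projection onto it. -/
lemma exists_epi_of_not_isFiniteSumOfIndecomposables {X : T}
    (hX : ¬ IsFiniteSumOfIndecomposables X) :
    ∃ (Y : T) (p : X ⟶ Y), ¬ IsFiniteSumOfIndecomposables Y ∧ Epi p ∧ ¬ IsIso p := by
  have h0 : ¬ IsZero X := fun h ↦ hX ⟨0, fun i ↦ X, fun i ↦ i.elim0,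
    ⟨h.iso ((IsZero.iff_id_eq_zero _).2 (biproduct.hom_ext _ _ fun i ↦ i.elim0))⟩⟩
  have h1 : ¬ Indecomposable X := fun h ↦ hX
    (isFiniteSumOfIndecomposables_of_fintype (J := Unit) (fun _ ↦ X) (fun _ ↦ h)
      (biproductUniqueIso fun _ : Unit ↦ X).symm)
  have fst_not_iso {Y Z : T} (hZ : ¬ IsZero Z) : ¬ IsIso (biprod.fst : Y ⊞ Z ⟶ Y) := fun _ ↦ by
    refine hZ ((IsZero.iff_id_eq_zero Z).2 ?_)
    have : (biprod.inr : Z ⟶ Y ⊞ Z) = 0 := by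
      rw [← cancel_mono (biprod.fst : Y ⊞ Z ⟶ Y)]
      simp
    rw [← biprod.inr_snd, this, zero_comp]
  have key {Y Z : T} (e : X ≅ Y ⊞ Z) (hZ : ¬ IsZero Z) (hY : ¬ IsFiniteSumOfIndecomposables Y) :
      ∃ (Y : T) (p : X ⟶ Y), ¬ IsFiniteSumOfIndecomposables Y ∧ Epi p ∧ ¬ IsIso p :=
    ⟨Y, e.hom ≫ biprod.fst, hY, inferInstance, fun _ ↦
      fst_not_iso hZ (IsIso.of_isIso_comp_left e.hom biprod.fst)⟩
  simp only [Indecomposable, not_and, not_forall, not_or] at h1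
  obtain ⟨Y, Z, e, hY, hZ⟩ := h1 h0
  by_cases hY' : IsFiniteSumOfIndecomposables Y
  · exact key (e ≪≫ biprod.braiding Y Z) hY fun hZ' ↦ hX (.biprod e hY' hZ')
  · exact key e hZ hY'

omit [Preadditive T] [HasFiniteBiproducts T] [HasBinaryBiproducts T] in
lemma epi_chainComp {X : ℕ → T} (φ : ∀ i, X i ⟶ X (i + 1)) [∀ i, Epi (φ i)] (n : ℕ) :
    Epi (chainComp φ n) := by
  induction n with
  | zero => exact inferInstanceAs (Epi (φ 0))
  | succ n ih => exact epi_comp _ _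

/-- Otherwise there is an infinite sequence of non-invertible epimorphisms. Cancelling the epic
composite in the stabilisation equation makes one of them a split monomorphism, hence invertible. -/
lemma SequencesStabilize.isFiniteSumOfIndecomposables (hT : SequencesStabilize T) (X : T) :
    IsFiniteSumOfIndecomposables X := by
  by_contra hX
  choose Y p hY hp hp' using fun X : {X : T // ¬ IsFiniteSumOfIndecomposables X} ↦
    exists_epi_of_not_isFiniteSumOfIndecomposables X.2
  let s : ℕ → {X : T // ¬ IsFiniteSumOfIndecomposables X} := fun n ↦
    Nat.rec ⟨X, hX⟩ (fun _ Z ↦ ⟨Y Z, hY Z⟩) n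
  obtain ⟨n, r, hr⟩ := hT (fun n ↦ (s n).1) (fun n ↦ p (s n))
  have : ∀ i, Epi (p (s i)) := fun i ↦ hp _
  have := epi_chainComp (X := fun n ↦ (s n).1) (fun n ↦ p (s n)) n
  have h : p (s (n + 1)) ≫ r = 𝟙 _ := by
    rw [← cancel_epi (chainComp (X := fun n ↦ (s n).1) (fun n ↦ p (s n)) n)]
    exact hr.trans (Category.comp_id _).symm
  have : IsSplitMono (p (s (n + 1))) := ⟨⟨⟨r, h⟩⟩⟩
  exact hp' (s (n + 1)) (isIso_of_epi_of_isSplitMono _)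

end Decomposition

section Indecomposables

variable [Preadditive T] [HasBinaryBiproducts T]

/-- Splitting e and 1 - e writes X as the biproduct of their images, one of which must vanish. -/
lemma eq_zero_or_eq_id_of_indecomposable [IsIdempotentComplete T] {X : T} (hX : Indecomposable X)
    (e : X ⟶ X) (he : e ≫ e = e) : e = 0 ∨ e = 𝟙 X := by
  obtain ⟨Y, i, p, hip, hpi⟩ := IsIdempotentComplete.idempotents_split X e he
  obtain ⟨Z, j, q, hjq, hqj⟩ := IsIdempotentComplete.idempotents_split X (𝟙 X - e)
    (Idempotents.idem_of_id_sub_idem e he)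
  have hiq : i ≫ q = 0 := by
    calc i ≫ q = (i ≫ (q ≫ j)) ≫ q := by simp [hjq]
    _ = 0 := by rw [hqj, ← hpi]; simp [reassoc_of% hip]
  have hjp : j ≫ p = 0 := by
    calc j ≫ p = (j ≫ (p ≫ i)) ≫ p := by simp [hip]
    _ = (j ≫ (𝟙 X - q ≫ j)) ≫ p := by rw [hpi, hqj, sub_sub_cancel]
    _ = 0 := by simp [reassoc_of% hjq]
  let φ : X ≅ Y ⊞ Z :=
    { hom := biprod.lift p q
      inv := biprod.desc i j
      hom_inv_id := by rw [biprod.lift_desc, hpi, hqj, add_sub_cancel]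
      inv_hom_id := by
        ext <;> simp [hip, hiq, hjp, hjq] }
  rcases hX.2 _ _ φ with h | h
  · left
    rw [← hpi, h.eq_of_tgt p 0, zero_comp]
  · right
    rw [h.eq_of_tgt q 0, zero_comp] at hqj
    exact (sub_eq_zero.1 hqj.symm).symm

lemma isIso_of_isSplitMono_of_indecomposable [IsIdempotentComplete T] {X Y : T}
    (hX : ¬ IsZero X) (hY : Indecomposable Y) (i : X ⟶ Y) (r : Y ⟶ X) (h : i ≫ r = 𝟙 X) :
    IsIso i := by
  rcases eq_zero_or_eq_id_of_indecomposable hY (r ≫ i) (by simp [reassoc_of% h]) with h' | h'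
  · refine (hX ((IsZero.iff_id_eq_zero X).2 ?_)).elim
    calc 𝟙 X = i ≫ (r ≫ i) ≫ r := by simp [h]
    _ = 0 := by rw [h', zero_comp, comp_zero]
  · exact ⟨r, h, h'⟩

lemma SequencesStabilize.isLocalRing_end (hT : SequencesStabilize T) [IsIdempotentComplete T]
    {X : T} (hX : Indecomposable X) : IsLocalRing (End X) := by
  have : Nontrivial (End X) := ⟨1, 0, fun h ↦ hX.1 ((IsZero.iff_id_eq_zero X).2 h)⟩
  refine isLocalRing_of_chainCondition (eq_zero_or_eq_id_of_indecomposable hX) fun c hc ↦ ?_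
  simp only [Submodule.mem_span_singleton, smul_eq_mul] at hc ⊢
  choose r hr using hc
  -- A left multiple in `End X` is a postcomposition, so the sequence c 0, r 0, r 1, … has
  -- composites c n.
  have hcomp (n : ℕ) : chainComp (X := fun _ ↦ X) (fun n ↦ Nat.casesOn n (c 0) r) n = c n := by
    induction n with
    | zero => rfl
    | succ n ih => exact (congrArg (· ≫ r n) ih).trans (hr n)
  obtain ⟨n, t, ht⟩ := hT (fun _ ↦ X) (fun n ↦ Nat.casesOn n (c 0) r)
  refine ⟨n, t, ?_⟩
  rw [hcomp n] at ht
  rw [← hr]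
  exact (Category.assoc _ _ _).trans ht

lemma SequencesStabilize.chainsEventuallyZero (hT : SequencesStabilize T) [IsIdempotentComplete T] :
    ChainsEventuallyZero T := by
  intro X φ hX hφ
  obtain ⟨n, r, hr⟩ := hT X φ
  refine ⟨n, ?_⟩
  have := hT.isLocalRing_end (hX (n + 1))
  let f : End (X (n + 1)) := φ (n + 1) ≫ r
  -- If f is invertible, φ (n + 1) is a split monomorphism between indecomposables, hence an
  -- isomorphism; if 1 - f is, the equation c f = c for the composite c gives c = 0.
  rcases IsLocalRing.isUnit_or_isUnit_of_add_one (add_sub_cancel f 1) with h | h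
  · have : IsIso (φ (n + 1) ≫ r) := (isUnit_iff_isIso f).1 h
    exact (hφ _ (isIso_of_isSplitMono_of_indecomposable (hX _).1 (hX _) _
      (r ≫ inv (φ (n + 1) ≫ r)) (by rw [← Category.assoc, IsIso.hom_inv_id]))).elim
  · have : IsIso (𝟙 _ - φ (n + 1) ≫ r) := (isUnit_iff_isIso (1 - f)).1 h
    rw [← cancel_mono (𝟙 _ - φ (n + 1) ≫ r), zero_comp, Preadditive.comp_sub, hr, Category.comp_id,
      sub_self]

lemma SequencesStabilize.isKrullRemakSchmidt [HasFiniteBiproducts T]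
    (hT : SequencesStabilize T) [IsIdempotentComplete T] : IsKrullRemakSchmidt T := by
  intro X
  obtain ⟨n, Y, hY, h⟩ := hT.isFiniteSumOfIndecomposables X
  exact ⟨n, Y, fun i ↦ ⟨hY i, hT.isLocalRing_end (hY i)⟩, h⟩

end Indecomposables

/-! ### Bases modulo the radical, and Nakayama's lemma. -/

section Radical

variable {T : Type u} [Category.{v} T] [Preadditive T] [HasBinaryBiproducts T]

/-- The elements of `F` at `C` generated by non-isomorphisms to indecomposable objects. -/
def radical (F : Tᵒᵖ ⥤ AddCommGrpCat.{v}) (C : T) : AddSubgroup (F.obj (op C)) :=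
  AddSubgroup.closure {x | ∃ (D : T) (φ : C ⟶ D) (z : F.obj (op D)),
    Indecomposable D ∧ ¬ IsIso φ ∧ F.map φ.op z = x}

variable {F : Tᵒᵖ ⥤ AddCommGrpCat.{v}}

lemma mem_radical {C D : T} (hD : Indecomposable D) (φ : C ⟶ D) (hφ : ¬ IsIso φ)
    (z : F.obj (op D)) : F.map φ.op z ∈ radical F C :=
  AddSubgroup.subset_closure ⟨D, φ, z, hD, hφ, rfl⟩

lemma radical_le {C : T} {S : AddSubgroup (F.obj (op C))}
    (h : ∀ (D : T) (φ : C ⟶ D) (z : F.obj (op D)), Indecomposable D → ¬ IsIso φ →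
      F.map φ.op z ∈ S) : radical F C ≤ S := by
  rw [radical, AddSubgroup.closure_le]
  rintro _ ⟨D, φ, z, hD, hφ, rfl⟩
  exact h D φ z hD hφ

lemma radical_le_comap {B C : T} (f : B ⟶ C) [IsIso f] :
    radical F C ≤ (radical F B).comap (F.map f.op).hom :=
  radical_le fun D φ z hD hφ ↦ by
    change F.map f.op _ ∈ radical F B
    rw [← map_op_comp_apply]
    exact mem_radical hD (f ≫ φ) (fun _ ↦ hφ (IsIso.of_isIso_comp_left f φ)) z

section Family

variable {ι : Type*} (X : ι → T) (y : ∀ i, F.obj (op (X i)))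

/-- The subfunctor of `F` generated by the elements of a family with indices in a given set. -/
def spanOn (S : Set ι) (C : T) : AddSubgroup (F.obj (op C)) :=
  AddSubgroup.closure {x | ∃ i ∈ S, ∃ a : C ⟶ X i, F.map a.op (y i) = x}

variable {X y}

omit [Preadditive T] [HasBinaryBiproducts T] in
lemma mem_spanOn {S : Set ι} {C : T} {i : ι} (hi : i ∈ S) (a : C ⟶ X i) :
    F.map a.op (y i) ∈ spanOn X y S C :=
  AddSubgroup.subset_closure ⟨i, hi, a, rfl⟩

omit [Preadditive T] [HasBinaryBiproducts T] in
lemma spanOn_le {S : Set ι} {C : T} {U : AddSubgroup (F.obj (op C))}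
    (h : ∀ i ∈ S, ∀ a : C ⟶ X i, F.map a.op (y i) ∈ U) : spanOn X y S C ≤ U := by
  rw [spanOn, AddSubgroup.closure_le]
  rintro _ ⟨i, hi, a, rfl⟩
  exact h i hi a

omit [Preadditive T] [HasBinaryBiproducts T] in
lemma spanOn_le_comap {S : Set ι} {B C : T} (f : B ⟶ C) :
    spanOn X y S C ≤ (spanOn X y S B).comap (F.map f.op).hom :=
  spanOn_le fun _ hi a ↦ by
    change F.map f.op _ ∈ spanOn X y S B
    rw [← map_op_comp_apply]
    exact mem_spanOn hi (f ≫ a)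

variable (X y)

/-- A family of elements is independent modulo the radical on a set of indices. -/
def IsIndependentOn (S : Set ι) : Prop :=
  ∀ (C : T), Indecomposable C → ∀ (s : Finset ι), (s : Set ι) ⊆ S → ∀ a : ∀ i, C ⟶ X i,
    ∑ i ∈ s, F.map (a i).op (y i) ∈ radical F C → ∀ i ∈ s, ¬ IsIso (a i)

/-- Zorn's lemma applies because independence only tests finite subsets. -/
lemma exists_maximal_isIndependentOn :
    ∃ S, Maximal (fun S : Set ι ↦ (∀ i ∈ S, Indecomposable (X i)) ∧ IsIndependentOn X y S) S := by
  refine zorn_subset {S | (∀ i ∈ S, Indecomposable (X i)) ∧ IsIndependentOn X y S}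
    fun c hc hc' ↦ ⟨⋃₀ c, ⟨?_, ?_⟩, fun s hs ↦ Set.subset_sUnion_of_mem hs⟩
  · rintro i ⟨S, hS, hi⟩
    exact (hc hS).1 i hi
  · intro C hC s hs a ha
    rcases c.eq_empty_or_nonempty with rfl | hne
    · intro i hi
      simpa using hs hi
    · obtain ⟨S, hS, hsS⟩ := hc'.directedOn.exists_mem_subset_of_finset_subset_biUnion
        (f := id) hne (s := s) (by rwa [Set.sUnion_eq_biUnion] at hs)
      exact (hc hS).2 C hC s hsS a ha

variable {X y}

/-- Adding e to S would create a combination in the radical with an invertible coefficient. The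
coefficient of e is itself invertible, since otherwise its term lies in the radical and S is already
dependent; hence y e can be solved for. -/
lemma mem_sup_of_maximal {S : Set ι}
    (hS : Maximal (fun S : Set ι ↦ (∀ i ∈ S, Indecomposable (X i)) ∧ IsIndependentOn X y S) S)
    {e : ι} (he : Indecomposable (X e)) : y e ∈ spanOn X y S (X e) ⊔ radical F (X e) := by
  classical
  by_cases heS : e ∈ S
  · exact AddSubgroup.mem_sup_left (by simpa using mem_spanOn (y := y) heS (𝟙 (X e)))
  have h : ¬ IsIndependentOn X y (insert e S) := fun h ↦ heS <|
    hS.2 ⟨fun i hi ↦ hi.elim (fun h ↦ h ▸ he) (hS.1.1 i), h⟩ (Set.subset_insert e S)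
      (Set.mem_insert e S)
  simp only [IsIndependentOn, not_forall, not_not] at h
  obtain ⟨C, hC, s, hs, a, ha, i, hi, hai⟩ := h
  have hes : e ∈ s := by
    by_contra hes
    refine hS.1.2 C hC s (fun j hj ↦ (hs hj).resolve_left ?_) a ha i hi hai
    rintro rfl
    exact hes hj
  have hs' : ((s.erase e : Finset ι) : Set ι) ⊆ S := fun j hj ↦ by
    simp only [Finset.coe_erase, Set.mem_sdiff, Set.mem_singleton_iff] at hj
    exact (hs hj.1).resolve_left hj.2
  rw [← Finset.add_sum_erase _ _ hes] at ha
  by_cases hae : IsIso (a e)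
  · have h₁ : F.map (a e).op (y e) ∈ spanOn X y S C ⊔ radical F C := by
      rw [← add_sub_cancel_right (F.map (a e).op (y e))
        (∑ j ∈ s.erase e, F.map (a j).op (y j))]
      exact sub_mem (AddSubgroup.mem_sup_right ha) (AddSubgroup.mem_sup_left
        (sum_mem fun j hj ↦ mem_spanOn (hs' hj) _))
    have h₂ : spanOn X y S C ⊔ radical F C ≤
        (spanOn X y S (X e) ⊔ radical F (X e)).comap (F.map (inv (a e)).op).hom :=
      sup_le ((spanOn_le_comap _).trans (AddSubgroup.comap_mono le_sup_left))
        ((radical_le_comap _).trans (AddSubgroup.comap_mono le_sup_right))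
    have h₃ := h₂ h₁
    rw [AddSubgroup.mem_comap] at h₃
    have h₄ := map_op_comp_apply F (inv (a e)) (a e) (y e)
    rw [IsIso.inv_hom_id, map_op_id_apply] at h₄
    exact h₄ ▸ h₃
  · exfalso
    have h₁ := (add_mem_cancel_left (mem_radical he (a e) hae (y e))).1 ha
    refine hS.1.2 C hC _ hs' a h₁ i (Finset.mem_erase.2 ⟨?_, hi⟩) hai
    rintro rfl
    exact hae hai

end Family

variable (F) in
/-- Every functor has a family of elements at indecomposable objects which is independent modulo
the radical and generates modulo the radical. -/
lemma exists_basis_mod_radical [EssentiallySmall.{v} T] :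
    ∃ (I : Type v) (X : I → T) (y : ∀ i, F.obj (op (X i))), (∀ i, Indecomposable (X i)) ∧
      IsIndependentOn X y Set.univ ∧
      ∀ C, Indecomposable C → spanOn X y Set.univ C ⊔ radical F C = ⊤ := by
  classical
  -- Taking all elements of F over a small model keeps the index set in `Type v`.
  let E := Σ X : SmallModel.{v} T, F.obj (op ((equivSmallModel.{v} T).inverse.obj X))
  let X : E → T := fun e ↦ (equivSmallModel.{v} T).inverse.obj e.1
  let y : ∀ e : E, F.obj (op (X e)) := fun e ↦ e.2
  obtain ⟨S, hS⟩ := exists_maximal_isIndependentOn X y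
  have hspan (C : T) : spanOn X y S C ≤ spanOn (fun i : S ↦ X i) (fun i ↦ y i) Set.univ C :=
    spanOn_le fun i hi a ↦
      mem_spanOn (X := fun i : S ↦ X i) (y := fun i ↦ y i) (Set.mem_univ ⟨i, hi⟩) a
  refine ⟨S, fun i ↦ X i, fun i ↦ y i, fun i ↦ hS.1.1 i i.2, fun C hC s _ a ha i hi ↦ ?_,
    fun C hC ↦ ?_⟩
  · let a' (e : E) : C ⟶ X e := if h : e ∈ S then a ⟨e, h⟩ else 0
    have ha' (i : S) : a' i = a i := dif_pos i.2
    rw [← ha']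
    refine hS.1.2 C hC (s.map (Function.Embedding.subtype _)) (by simp) a' ?_ i (by simpa using hi)
    have h : ∑ i ∈ s.map (Function.Embedding.subtype _), F.map (a' i).op (y i) =
        ∑ i ∈ s, F.map (a i).op (y i) :=
      (Finset.sum_map _ _ _).trans (Finset.sum_congr rfl fun i _ ↦
        congrArg (fun b : C ⟶ X i ↦ F.map b.op (y i)) (ha' i))
    rw [h]
    exact ha
  · rw [eq_top_iff]
    intro x _
    let f : C ≅ (equivSmallModel.{v} T).inverse.obj ((equivSmallModel.{v} T).functor.obj C) :=
      (equivSmallModel.{v} T).unitIso.app C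
    let e : E := ⟨(equivSmallModel.{v} T).functor.obj C, F.map f.inv.op x⟩
    have he : Indecomposable (X e) :=
      ⟨fun h ↦ hC.1 (h.of_iso f), fun Y Z g ↦ hC.2 Y Z (f ≪≫ g)⟩
    have h₁ := mem_sup_of_maximal hS he
    have h₂ : spanOn X y S (X e) ⊔ radical F (X e) ≤
        (spanOn (fun i : S ↦ X i) (fun i ↦ y i) Set.univ C ⊔ radical F C).comap
          (F.map f.hom.op).hom :=
      sup_le ((spanOn_le_comap _).trans (AddSubgroup.comap_mono ((hspan C).trans le_sup_left)))
        ((radical_le_comap f.hom).trans (AddSubgroup.comap_mono le_sup_right))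
    have h₃ := h₂ h₁
    rw [AddSubgroup.mem_comap] at h₃
    have h₄ := map_op_comp_apply F f.hom f.inv x
    rw [f.hom_inv_id, map_op_id_apply] at h₄
    exact h₄ ▸ h₃

/-- Nakayama's lemma: an element outside the span forces some F(φ) z outside it with φ a
non-isomorphism to an indecomposable. Repeating this for z gives a chain whose composites never
vanish. -/
lemma spanOn_eq_top_of_indecomposable [F.Additive] (hT : ChainsEventuallyZero T) {ι : Type*}
    {X : ι → T} {y : ∀ i, F.obj (op (X i))} {S : Set ι}
    (hy : ∀ C, Indecomposable C → spanOn X y S C ⊔ radical F C = ⊤) {C : T}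
    (hC : Indecomposable C) : spanOn X y S C = ⊤ := by
  by_contra h
  obtain ⟨x, hx⟩ : ∃ x, x ∉ spanOn X y S C := by
    by_contra! hx
    exact h (eq_top_iff.2 fun x _ ↦ hx x)
  refine false_of_chainsEventuallyZero hT
    (fun D ψ ↦ Indecomposable D ∧ ∃ z : F.obj (op D), F.map ψ.op z ∉ spanOn X y S C) ?_ ?_ ?_
  · rintro D ψ ⟨hD, z, hz⟩
    refine ⟨hD, ?_⟩
    rintro rfl
    rw [map_op_zero_apply] at hz
    exact hz (zero_mem _)
  · exact ⟨hC, x, by rwa [map_op_id_apply]⟩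
  · rintro D ψ ⟨hD, z, hz⟩
    by_contra! h
    refine hz ?_
    have h₁ : spanOn X y S D ⊔ radical F D ≤ (spanOn X y S C).comap (F.map ψ.op).hom :=
      sup_le (spanOn_le_comap ψ) (radical_le fun D' φ z' hD' hφ ↦ by
        have := (h D' φ hφ hD' z')
        rwa [map_op_comp_apply] at this)
    rw [hy D hD] at h₁
    exact h₁ (AddSubgroup.mem_top z)

end Radical

/-! ### Cohomological functors are direct sums of representables under condition (2). -/

section Main

variable {T : Type u} [Category.{v} T] [Preadditive T]

lemma map_op_ext [HasFiniteBiproducts T] {F : Tᵒᵖ ⥤ AddCommGrpCat.{v}} [F.Additive] {X : T}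
    {n : ℕ} {Y : Fin n → T} (e : X ≅ ⨁ Y) (x : F.obj (op X)) :
    x = ∑ i, F.map (e.hom ≫ biproduct.π Y i).op (F.map (biproduct.ι Y i ≫ e.inv).op x) := by
  simp only [← map_op_comp_apply]
  rw [← map_op_sum_apply]
  have : ∑ i, (e.hom ≫ biproduct.π Y i) ≫ biproduct.ι Y i ≫ e.inv = 𝟙 X := by
    have h (i : Fin n) : (e.hom ≫ biproduct.π Y i) ≫ biproduct.ι Y i ≫ e.inv =
      e.hom ≫ (biproduct.π Y i ≫ biproduct.ι Y i) ≫ e.inv := by simp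
    rw [Finset.sum_congr rfl fun i _ ↦ h i, ← Preadditive.comp_sum, ← Preadditive.sum_comp,
      sum_π_comp_ι, Category.id_comp, e.hom_inv_id]
  rw [this, map_op_id_apply]

/-- The natural transformation corresponding to an element of an additive functor. -/
def yonedaDesc (F : Tᵒᵖ ⥤ AddCommGrpCat.{v}) [F.Additive] {X : T} (x : F.obj (op X)) :
    preadditiveYoneda.obj X ⟶ F where
  app C := AddCommGrpCat.ofHom
    { toFun := fun c : C.unop ⟶ X ↦ F.map c.op x
      map_zero' := map_op_zero_apply F x
      map_add' := fun _ _ ↦ map_op_add_apply F _ _ x }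
  naturality C D f := by
    ext c
    exact map_op_comp_apply F f.unop c x

variable [HasZeroObject T]
  [HasShift T ℤ] [∀ n : ℤ, (shiftFunctor T n).Additive] [Pretriangulated T]

variable {F : Tᵒᵖ ⥤ AddCommGrpCat.{v}} [F.IsHomological] {I : Type v} {X : I → T}
  {y : ∀ i, F.obj (op (X i))}

lemma spanOn_eq_top (hT : ∀ X : T, IsFiniteSumOfIndecomposables X) (hT' : ChainsEventuallyZero T)
    {S : Set I} (hy : ∀ C, Indecomposable C → spanOn X y S C ⊔ radical F C = ⊤)
    (C : T) : spanOn X y S C = ⊤ := by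
  obtain ⟨n, Y, hY, ⟨e⟩⟩ := hT C
  rw [eq_top_iff]
  intro x _
  rw [map_op_ext e x]
  refine sum_mem fun i _ ↦ spanOn_le_comap (e.hom ≫ biproduct.π Y i) ?_
  rw [spanOn_eq_top_of_indecomposable hT' hy (hY i)]
  exact AddSubgroup.mem_top _

variable (X y) in
/-- The map from a direct sum of representables determined by a family of elements. -/
noncomputable def sumDesc : sumYoneda X ⟶ F := Sigma.desc fun i ↦ yonedaDesc F (y i)

lemma sumDesc_app_ofHom {C : T} (i : I) (a : C ⟶ X i) :
    (sumDesc X y).app (op C) (ofHom (sumι X i) a) = F.map a.op (y i) :=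
  ConcreteCategory.congr_hom (congrArg
    (fun t : preadditiveYoneda.obj (X i) ⟶ F ↦ t.app (op C))
    (Sigma.ι_desc (fun i ↦ yonedaDesc F (y i)) i)) a

lemma exists_eq_sum_of_spanOn_eq_top {C : T} (h : spanOn X y Set.univ C = ⊤) (x : F.obj (op C)) :
    ∃ t : (sumYoneda X).obj (op C), (sumDesc X y).app (op C) t = x := by
  have : spanOn X y Set.univ C ≤ ((sumDesc X y).app (op C)).hom.range :=
    spanOn_le fun i _ a ↦ ⟨ofHom (sumι X i) a, sumDesc_app_ofHom i a⟩
  exact this (h ▸ AddSubgroup.mem_top x)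

lemma sumDesc_app_sum {C : T} (s : Finset I) (a : ∀ i, C ⟶ X i) :
    (sumDesc X y).app (op C) (∑ i ∈ s, ofHom (sumι X i) (a i)) =
      ∑ i ∈ s, F.map (a i).op (y i) := by
  rw [map_sum]
  exact Finset.sum_congr rfl fun i _ ↦ sumDesc_app_ofHom i (a i)

/-- A relation between the generators is not annihilated by all the relations between them. -/
lemma exists_relation (hy : ∀ C, spanOn X y Set.univ C = ⊤) {B C : T} (ψ : B ⟶ C) (s : Finset I)
    (a : ∀ i, C ⟶ X i) (ha : ∑ i ∈ s, F.map (a i).op (y i) = 0) {i : I} (hi : i ∈ s)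
    (hψ : ψ ≫ a i ≠ 0) :
    ∃ j ∈ s, ∃ (s' : Finset I) (a' : ∀ i, X j ⟶ X i),
      ∑ k ∈ s', F.map (a' k).op (y k) = 0 ∧ ∃ k ∈ s', ψ ≫ a j ≫ a' k ≠ 0 := by
  classical
  let Z : s → T := fun i ↦ X i
  -- The relation says that α kills the element of F(⨁ Z) with components y i. Since F is
  -- cohomological, this element comes from a weak cokernel W of α, where it is a combination of
  -- generators with coefficients c.
  let α : C ⟶ ⨁ Z := biproduct.lift fun i ↦ a i
  obtain ⟨W, b, hαb, -, -, hF⟩ := exists_weakCokernel α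
  obtain ⟨z, hz⟩ := hF F (∑ i : s, F.map (biproduct.π Z i).op (y i)) (by
    rw [map_sum, ← ha, ← Finset.sum_coe_sort s]
    refine Finset.sum_congr rfl fun i _ ↦ ?_
    rw [← map_op_comp_apply, biproduct.lift_π])
  obtain ⟨t, rfl⟩ := exists_eq_sum_of_spanOn_eq_top (hy W) z
  obtain ⟨s', c, rfl⟩ := exists_eq_sum_ι X t
  rw [sumDesc_app_sum] at hz
  let c' (k : I) : W ⟶ X k := if k ∈ s' then c k else 0
  let δ (j : s) (k : I) : X j ⟶ X k := if h : j = k then eqToHom (by rw [h]) else 0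
  -- Restricting to the summand X j expresses y j through the generators, which is a relation at X
  -- j.
  let a' (j : s) (k : I) : X j ⟶ X k := δ j k - biproduct.ι Z j ≫ b ≫ c' k
  have hδ (j : s) : ∑ k ∈ s ∪ s', F.map (δ j k).op (y k) = y j := by
    rw [Finset.sum_eq_single (j : I)]
    · simp [δ]
    · intro k _ hk
      simp only [δ, dif_neg (Ne.symm hk), map_op_zero_apply]
    · exact fun h ↦ (h (Finset.mem_union_left _ j.2)).elim
  have hc' : ∑ k ∈ s ∪ s', F.map (c' k).op (y k) = ∑ k ∈ s', F.map (c k).op (y k) := by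
    symm
    refine (Finset.sum_congr rfl fun k hk ↦ by simp only [c', if_pos hk]).trans
      (Finset.sum_subset Finset.subset_union_right fun k _ hk ↦ ?_)
    simp only [c', if_neg hk, map_op_zero_apply]
  have ha' (j : s) : ∑ k ∈ s ∪ s', F.map (a' j k).op (y k) = 0 := by
    simp only [a', map_op_sub_apply, Finset.sum_sub_distrib, hδ, map_op_comp_apply]
    rw [← map_sum, ← map_sum, hc', hz, map_sum, Finset.sum_eq_single j, ← map_op_comp_apply,
      biproduct.ι_π_self, map_op_id_apply, sub_self]
    · intro k _ hk
      rw [← map_op_comp_apply, biproduct.ι_π_ne _ hk.symm, map_op_zero_apply]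
    · simp
  -- If ψ ≫ a j killed all the new relations, summing over j would give ψ ≫ a i = ψ ≫ α ≫ b ≫ c' i =
  -- 0.
  by_contra! h
  refine hψ ?_
  have h₁ (j : s) (k : I) (hk : k ∈ s) :
      ψ ≫ a j ≫ δ j k = ψ ≫ (a j ≫ biproduct.ι Z j) ≫ b ≫ c' k := by
    have := h j j.2 _ (a' j) (ha' j) k (Finset.mem_union_left _ hk)
    simpa [a', sub_eq_zero] using this
  have h₂ : ∑ j : s, ψ ≫ (a j ≫ biproduct.ι Z j) ≫ b ≫ c' i = 0 := by
    rw [← Preadditive.comp_sum, ← Preadditive.sum_comp]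
    have : ∑ j : s, a j ≫ biproduct.ι Z j = α := by
      rw [← Category.comp_id α, ← sum_π_comp_ι, Preadditive.comp_sum]
      refine Finset.sum_congr rfl fun j _ ↦ ?_
      rw [← Category.assoc, biproduct.lift_π]
    rw [this, reassoc_of% hαb, zero_comp, comp_zero]
  rw [← h₂, ← Finset.sum_congr rfl fun j _ ↦ h₁ j i hi, Finset.sum_eq_single ⟨i, hi⟩]
  · simp [δ]
  · intro j _ hj
    have : (j : I) ≠ i := fun h ↦ hj (Subtype.ext h)
    simp only [δ, dif_neg this, comp_zero]
  · simp

/-- Zero lies in the radical, so independence makes all coefficients of a relation at an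
indecomposable non-isomorphisms. By `exists_relation`, a nonzero relation then continues along one
of its coefficients to another relation not killed by the composite so far, producing an endless
nonvanishing chain. -/
lemma eq_zero_of_sum_eq_zero (hT : ∀ X : T, IsFiniteSumOfIndecomposables X)
    (hT' : ChainsEventuallyZero T) (hX : ∀ i, Indecomposable (X i))
    (hy : ∀ C, spanOn X y Set.univ C = ⊤) (hy' : IsIndependentOn X y Set.univ)
    {C : T} (s : Finset I) (a : ∀ i, C ⟶ X i) (ha : ∑ i ∈ s, F.map (a i).op (y i) = 0)
    (i : I) (hi : i ∈ s) : a i = 0 := by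
  have key {C : T} (hC : Indecomposable C) (s : Finset I) (a : ∀ i, C ⟶ X i)
      (ha : ∑ i ∈ s, F.map (a i).op (y i) = 0) (i : I) (hi : i ∈ s) : a i = 0 := by
    by_contra hai
    refine false_of_chainsEventuallyZero hT' (fun D ψ ↦ Indecomposable D ∧
      ∃ (s : Finset I) (a : ∀ i, D ⟶ X i), ∑ i ∈ s, F.map (a i).op (y i) = 0 ∧
        ∃ i ∈ s, ψ ≫ a i ≠ 0) ?_ ⟨hC, s, a, ha, i, hi, by rwa [Category.id_comp]⟩ ?_
    · rintro D ψ ⟨hD, s, a, -, i, -, h⟩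
      refine ⟨hD, ?_⟩
      rintro rfl
      exact h zero_comp
    · rintro D ψ ⟨hD, s, a, ha, i, hi, h⟩
      obtain ⟨j, hj, s', a', ha', k, hk, h'⟩ := exists_relation hy ψ s a ha hi h
      exact ⟨X j, a j, hy' D hD s (Set.subset_univ _) a (ha ▸ zero_mem _) j hj, hX j, s', a', ha',
        k, hk, by rwa [Category.assoc]⟩
  obtain ⟨n, Y, hY, ⟨e⟩⟩ := hT C
  rw [← cancel_epi e.inv, comp_zero]
  refine biproduct.hom_ext' _ _ fun k ↦ ?_
  rw [comp_zero]
  refine key (hY k) s (fun i ↦ biproduct.ι Y k ≫ e.inv ≫ a i) ?_ i hi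
  simp only [map_op_comp_apply, ← map_sum, ha, map_zero]

theorem isDirectSumOfRepresentables_of_chainsEventuallyZero [EssentiallySmall.{v} T]
    (hT : ∀ X : T, IsFiniteSumOfIndecomposables X) (hT' : ChainsEventuallyZero T)
    (F : Tᵒᵖ ⥤ AddCommGrpCat.{v}) [F.IsHomological] : IsDirectSumOfRepresentables F := by
  obtain ⟨I, X, y, hX, hy', hy⟩ := exists_basis_mod_radical F
  replace hy := spanOn_eq_top hT hT' hy
  have hiso (C : Tᵒᵖ) : IsIso ((sumDesc X y).app C) := by
    rw [ConcreteCategory.isIso_iff_bijective]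
    refine ⟨(injective_iff_map_eq_zero ((sumDesc X y).app C).hom).2 fun t ht ↦ ?_,
      exists_eq_sum_of_spanOn_eq_top (hy C.unop)⟩
    obtain ⟨s, a, rfl⟩ := exists_eq_sum_ι X t
    refine Finset.sum_eq_zero fun i hi ↦ ?_
    rw [eq_zero_of_sum_eq_zero hT hT' hX hy hy' s a ((sumDesc_app_sum s a).symm.trans ht) i hi,
      map_zero]
  have := NatIso.isIso_of_isIso_app (sumDesc X y)
  exact ⟨I, X, ⟨(asIso (sumDesc X y)).symm⟩⟩

end Main

lemma exact_of_exact_evaluation {C : Type u} [Category.{v} C]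
    (S : ShortComplex (C ⥤ AddCommGrpCat.{v}))
    (h : ∀ X, (S.map ((evaluation _ _).obj X)).Exact) : S.Exact := by
  rw [ShortComplex.exact_iff_isZero_homology]
  refine Functor.isZero _ fun X ↦ ?_
  exact IsZero.of_iso ((ShortComplex.exact_iff_isZero_homology _).1 (h X))
    (S.mapHomologyIso ((evaluation _ _).obj X)).symm

/-! ### Kernels of maps between representables are finitely presented. -/

section KernelFunctor

variable {T : Type u} [Category.{v} T] [Preadditive T]

/-- The kernel of `Hom(-, X) ⟶ Hom(-, Y)`. -/
def kernelFunctor {X Y : T} (f : X ⟶ Y) : Tᵒᵖ ⥤ AddCommGrpCat.{v} where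
  obj C := AddCommGrpCat.of (Preadditive.rightComp C.unop f).ker
  map g := AddCommGrpCat.ofHom
    (((Preadditive.leftComp X g.unop).comp (AddSubgroup.subtype _)).codRestrict _ fun c ↦ by
      have : c.1 ≫ f = 0 := c.2
      change (g.unop ≫ c.1) ≫ f = 0
      rw [Category.assoc, this, comp_zero])
  map_id C := by
    ext c
    exact Category.id_comp c.1
  map_comp g h := by
    ext c
    exact Category.assoc h.unop g.unop c.1

instance {X Y : T} (f : X ⟶ Y) : (kernelFunctor f).Additive where
  map_add := by
    intro _ _ g h
    ext c
    exact Subtype.ext (Preadditive.add_comp _ _ _ g.unop h.unop c.1)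

/-- The inclusion of the kernel of `Hom(-, X) ⟶ Hom(-, Y)`. -/
def kernelFunctorι {X Y : T} (f : X ⟶ Y) : kernelFunctor f ⟶ preadditiveYoneda.obj X where
  app C := AddCommGrpCat.ofHom (AddSubgroup.subtype _)

instance {X Y : T} (f : X ⟶ Y) : Mono (kernelFunctorι f) := by
  have (C : Tᵒᵖ) : Mono ((kernelFunctorι f).app C) :=
    (AddCommGrpCat.mono_iff_injective _).2 Subtype.val_injective
  exact NatTrans.mono_of_mono_app _

variable [HasZeroObject T]
  [HasShift T ℤ] [∀ n : ℤ, (shiftFunctor T n).Additive] [Pretriangulated T]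

/-- A weak kernel k of f supplies the generator, and a weak kernel of k supplies the relations. -/
lemma isFinitelyPresented_kernelFunctor {X Y : T} (f : X ⟶ Y) :
    isFinitelyPresented T (kernelFunctor f) := by
  obtain ⟨K, k, hkf, hk, -⟩ := exists_weakKernel f
  obtain ⟨L, l, hlk, hl, -⟩ := exists_weakKernel k
  have w : preadditiveYoneda.map l ≫
      yonedaDesc (kernelFunctor f) (⟨k, hkf⟩ : (Preadditive.rightComp K f).ker) = 0 := by
    ext C c
    refine Subtype.ext ?_
    exact (Category.assoc _ _ _).trans ((congrArg _ hlk).trans comp_zero)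
  refine ⟨inferInstance, L, K, preadditiveYoneda.map l, yonedaDesc _ ⟨k, hkf⟩, w,
    exact_of_exact_evaluation _ fun C ↦ ?_, ?_⟩
  · rw [ShortComplex.ab_exact_iff]
    intro c hc
    exact hl c (congrArg Subtype.val hc)
  · have (C : Tᵒᵖ) : Epi ((yonedaDesc (kernelFunctor f)
        (⟨k, hkf⟩ : (Preadditive.rightComp K f).ker)).app C) := by
      rw [AddCommGrpCat.epi_iff_surjective]
      rintro ⟨c, hc⟩
      obtain ⟨c', hc'⟩ := hk c hc
      exact ⟨c', Subtype.ext hc'⟩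
    exact NatTrans.epi_of_epi_app _

end KernelFunctor

/-! ### Noetherian objects of the abelianisation and stabilisation of sequences. -/

section Abelianisation

variable {T : Type u} [Category.{v} T] [Preadditive T]

lemma isFinitelyPresented_yoneda (X : T) :
    isFinitelyPresented T (preadditiveYoneda.obj X) := by
  refine ⟨inferInstance, X, X, 0, 𝟙 _, zero_comp, ?_, inferInstance⟩
  rw [ShortComplex.exact_iff_mono _ rfl]
  exact inferInstanceAs (Mono (𝟙 _))

/-- The object of the abelianisation corresponding to an object of the category. -/
abbrev yonedaObj (X : T) : Abelianisation T := ⟨_, isFinitelyPresented_yoneda X⟩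

/-- Representables belong to the abelianisation, so by Yoneda a monomorphism there is injective at
every object. -/
lemma mono_hom {M N : Abelianisation T} (f : M ⟶ N) [Mono f] : Mono f.hom := by
  have hM : M.obj.Additive := M.property.1
  have (C : Tᵒᵖ) : Mono (f.hom.app C) := by
    rw [AddCommGrpCat.mono_iff_injective]
    intro x y hxy
    let x' : yonedaObj C.unop ⟶ M := ObjectProperty.homMk (yonedaDesc M.obj (X := C.unop) x)
    let y' : yonedaObj C.unop ⟶ M := ObjectProperty.homMk (yonedaDesc M.obj (X := C.unop) y)
    have h : x' ≫ f = y' ≫ f := by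
      refine ObjectProperty.hom_ext _ ?_
      change yonedaDesc M.obj _ ≫ f.hom = yonedaDesc M.obj _ ≫ f.hom
      ext D c
      refine (NatTrans.naturality_apply f.hom c.op x).trans
        (Eq.trans ?_ (NatTrans.naturality_apply f.hom c.op y).symm)
      rw [hxy]
    rw [cancel_mono] at h
    have h₁ := congrArg (fun t : yonedaObj C.unop ⟶ M ↦ ofHom t.hom (𝟙 C.unop)) h
    exact (map_op_id_apply M.obj x).symm.trans (h₁.trans (map_op_id_apply M.obj y))
  exact NatTrans.mono_of_mono_app _

/-- It suffices that the generator of P lies in Q: the epimorphism π has the left lifting property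
against the monomorphism `Q.arrow`, and the diagonal is the inclusion. -/
lemma subobject_le_of_generator {M : Abelianisation T} (P Q : Subobject M) {Y : T}
    (π : preadditiveYoneda.obj Y ⟶ (P : Abelianisation T).obj) [Epi π]
    (q : (Q : Abelianisation T).obj.obj (op Y))
    (hq : Q.arrow.hom.app (op Y) q = P.arrow.hom.app (op Y) (ofHom π (𝟙 Y))) : P ≤ Q := by
  have := (Q : Abelianisation T).property.1
  have := mono_hom Q.arrow
  have sq : CommSq (yonedaDesc _ q) π Q.arrow.hom P.arrow.hom := ⟨by
    ext C c
    refine (NatTrans.naturality_apply Q.arrow.hom (Quiver.Hom.op c) q).trans ?_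
    rw [hq]
    refine (NatTrans.naturality_apply P.arrow.hom (Quiver.Hom.op c) _).symm.trans ?_
    exact congrArg (P.arrow.hom.app C) ((map_ofHom π c (𝟙 Y)).trans
      (congrArg (ofHom π) (Category.comp_id (show C.unop ⟶ Y from c))))⟩
  have : StrongEpi π := strongEpi_of_epi π
  exact Subobject.le_of_comm (ObjectProperty.homMk sq.lift) (ObjectProperty.hom_ext _ sq.fac_right)

variable [HasZeroObject T]
  [HasShift T ℤ] [∀ n : ℤ, (shiftFunctor T n).Additive] [Pretriangulated T]

lemma sequencesStabilize_of_isNoetherianObject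
    (hT : ∀ M : Abelianisation T, IsNoetherianObject M) : SequencesStabilize T := by
  intro X φ
  let K (n : ℕ) : Abelianisation T := ⟨_, isFinitelyPresented_kernelFunctor (chainComp φ n)⟩
  let i (n : ℕ) : K n ⟶ yonedaObj (X 0) := ObjectProperty.homMk (kernelFunctorι (chainComp φ n))
  have hi (n : ℕ) : Mono (i n) :=
    (isFinitelyPresented T).ι.mono_of_mono_map (inferInstanceAs (Mono (kernelFunctorι _)))
  have hle (n : ℕ) : Subobject.mk (i n) ≤ Subobject.mk (i (n + 1)) := by
    refine Subobject.mk_le_mk_of_comm (ObjectProperty.homMk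
      { app C := AddCommGrpCat.ofHom (AddSubgroup.inclusion fun c hc ↦ ?_) }) ?_
    · have : c ≫ chainComp φ n = 0 := hc
      change c ≫ chainComp φ n ≫ φ (n + 1) = 0
      rw [reassoc_of% this, zero_comp]
    · rfl
  have := hT (yonedaObj (X 0))
  obtain ⟨n, hn⟩ := monotone_chain_condition_of_isNoetherianObject
    ⟨fun n ↦ Subobject.mk (i n), monotone_nat_of_le_succ hle⟩
  have hn' : Subobject.mk (i (n + 1)) ≤ Subobject.mk (i n) := (hn (n + 1) (Nat.le_succ n)).ge
  -- As the two kernels agree, l is killed by `chainComp φ n`, which therefore factors through the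
  -- weak cokernel `chainComp φ (n + 1)` of l.
  obtain ⟨L, l, hl, -, h⟩ := exists_weakKernel (chainComp φ (n + 1))
  let l' : (K (n + 1)).obj.obj (op L) := (⟨l, hl⟩ : (Preadditive.rightComp L _).ker)
  let g := Subobject.ofMkLEMk _ _ hn'
  let m : (Preadditive.rightComp L (chainComp φ n)).ker := g.hom.app (op L) l'
  have hg : m.1 = l :=
    ConcreteCategory.congr_hom (congrArg (fun t : K (n + 1) ⟶ yonedaObj (X 0) ↦ t.hom.app (op L))
      (Subobject.ofMkLEMk_comp hn')) l'
  obtain ⟨t, ht⟩ := h (chainComp φ n) (by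
    rw [← hg]
    exact m.2)
  exact ⟨n, t, (Category.assoc _ _ _).symm.trans ht⟩

lemma SequencesStabilize.isNoetherianObject (hT : SequencesStabilize T) (M : Abelianisation T) :
    IsNoetherianObject M := by
  rw [isNoetherianObject_iff_not_strictMono]
  intro P hP
  obtain ⟨_, X, Y, φ, π, w, hex, hπ⟩ := M.property
  choose _ _ Z _ ρ _ _ hρ using fun n ↦ (P n : Abelianisation T).property
  obtain ⟨f, rfl⟩ := preadditiveYoneda.map_surjective φ
  have hπ' {C : T} (x : M.obj.obj (op C)) : ∃ c : C ⟶ Y, ofHom π c = x :=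
    (AddCommGrpCat.epi_iff_surjective _).1 (inferInstance : Epi (π.app (op C))) x
  have hρ' (n : ℕ) {C : T} (x : (P n : Abelianisation T).obj.obj (op C)) :
      ∃ c : C ⟶ Z n, ofHom (ρ n) c = x :=
    (AddCommGrpCat.epi_iff_surjective _).1 (inferInstance : Epi ((ρ n).app (op C))) x
  have hfπ {C : T} (c : C ⟶ X) : ofHom π (c ≫ f) = 0 :=
    ConcreteCategory.congr_hom (congrArg (fun t : preadditiveYoneda.obj X ⟶ M.obj ↦
      t.app (op C)) w) c
  have hex' {C : T} (c : C ⟶ Y) (hc : ofHom π c = 0) : ∃ a, a ≫ f = c := by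
    have h := hex.map ((evaluation _ _).obj (op C))
    rw [ShortComplex.ab_exact_iff] at h
    exact h c hc
  choose g hg using fun n ↦ hπ' ((P n).arrow.hom.app (op (Z n)) (ofHom (ρ n) (𝟙 (Z n))))
  have hgc (n : ℕ) {C : T} (c : C ⟶ Z n) :
      ofHom π (c ≫ g n) = (P n).arrow.hom.app (op C) (ofHom (ρ n) c) := by
    rw [← map_ofHom, hg, ← NatTrans.naturality_apply, map_ofHom, Category.comp_id]
  -- The preimage of P n in Hom(-, Y) is the image of (f, g n), which is also the kernel of h n.
  -- Larger subobjects thus give successive factorisations of the maps h.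
  choose W h hfg hweak hfac _ using fun n ↦ exists_weakCokernel (biprod.desc f (g n))
  have hf (n : ℕ) : f ≫ h n = 0 := by
    simpa using congrArg (biprod.inl ≫ ·) (hfg n)
  have hgh (n : ℕ) : g n ≫ h n = 0 := by
    simpa using congrArg (biprod.inr ≫ ·) (hfg n)
  have ht (n : ℕ) : ∃ t, h n ≫ t = h (n + 1) := by
    refine hfac n (h (n + 1)) (biprod.hom_ext' _ _ (by simpa using hf (n + 1)) ?_)
    rw [biprod.inr_desc_assoc, comp_zero]
    let e := (P n).ofLE (P (n + 1)) (hP.monotone (Nat.le_succ n))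
    obtain ⟨b, hb⟩ := hρ' (n + 1) (e.hom.app _ (ofHom (ρ n) (𝟙 (Z n))))
    have hb' : ofHom π (b ≫ g (n + 1)) = ofHom π (g n) := by
      rw [hgc, hb, hg]
      exact ConcreteCategory.congr_hom (congrArg (fun t : (P n : Abelianisation T) ⟶ M ↦
        t.hom.app (op (Z n))) (Subobject.ofLE_arrow (hP.monotone (Nat.le_succ n)))) _
    obtain ⟨a, ha⟩ := hex' (g n - b ≫ g (n + 1)) (by rw [map_sub, hb', sub_self])
    rw [← sub_add_cancel (g n) (b ≫ g (n + 1)), ← ha]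
    simp [hf, hgh]
  choose t ht using ht
  -- Putting Y in front shifts the index, so that the composites of τ are exactly the maps h n.
  let V : ℕ → T
    | 0 => Y
    | n + 1 => W n
  let τ : ∀ i, V i ⟶ V (i + 1)
    | 0 => h 0
    | n + 1 => t n
  have hcomp (n : ℕ) : chainComp τ n = h n := by
    induction n with
    | zero => rfl
    | succ n ih => exact (congrArg (· ≫ t n) ih).trans (ht n)
  obtain ⟨n, r, hr⟩ := hT V τ
  rw [hcomp n] at hr
  have hr' : h (n + 1) ≫ r = h n := by
    rw [← ht, Category.assoc]
    exact hr
  -- Stabilisation makes h n kill g (n + 1), so the generator of P (n + 1) already lies in P n,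
  -- against strictness.
  obtain ⟨c, hc⟩ := hweak n (g (n + 1)) (by rw [← hr', reassoc_of% (hgh (n + 1)), zero_comp])
  refine (hP (Nat.lt_succ_self n)).not_ge
    (subobject_le_of_generator _ _ (ρ (n + 1)) (ofHom (ρ n) (c ≫ biprod.snd)) ?_)
  rw [← hgc, ← hg, ← hc, ← sub_eq_zero, ← map_sub]
  have : (c ≫ biprod.snd) ≫ g n - c ≫ biprod.desc f (g n) = (- c ≫ biprod.fst) ≫ f := by
    rw [biprod.desc_eq]
    simp
  rw [this, hfπ]

end Abelianisation

end TriangulatedNoetherian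

theorem theorem2p1 (T : Type u) [Category.{v} T] [Preadditive T] [HasZeroObject T]
    [HasShift T ℤ] [∀ n : ℤ, (shiftFunctor T n).Additive] [Pretriangulated T]
    [IsTriangulated T] [EssentiallySmall.{v} T] :
    List.TFAE [
      ∀ F : Tᵒᵖ ⥤ AddCommGrpCat.{v}, F.IsHomological →
        TriangulatedNoetherian.IsDirectSumOfRepresentables F,
      TriangulatedNoetherian.IsKrullRemakSchmidt T ∧
        TriangulatedNoetherian.ChainsEventuallyZero T,
      IsIdempotentComplete T ∧
        ∀ M : TriangulatedNoetherian.Abelianisation T, IsNoetherianObject M] := by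
  tfae_have 1 → 3 := fun h ↦
    ⟨TriangulatedNoetherian.isIdempotentComplete_of_isDirectSumOfRepresentables h,
      (TriangulatedNoetherian.sequencesStabilize_of_isDirectSumOfRepresentables
        h).isNoetherianObject⟩
  tfae_have 3 → 2 := fun ⟨_, h⟩ ↦
    have h' := TriangulatedNoetherian.sequencesStabilize_of_isNoetherianObject h
    ⟨h'.isKrullRemakSchmidt, h'.chainsEventuallyZero⟩
  tfae_have 2 → 1 := fun ⟨h, h'⟩ F _ ↦
    TriangulatedNoetherian.isDirectSumOfRepresentables_of_chainsEventuallyZero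
      (fun X ↦ let ⟨n, Y, hY, e⟩ := h X; ⟨n, Y, fun i ↦ (hY i).1, e⟩) h' F
  tfae_finish
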